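/- Theorem 2.5. Let $n\ge 1$, $1<q<p<\infty$, $\frac1r:=\frac1q-\frac1p$ and $b\in L^r(\mathbb R^n)$; all functions are complex-valued. Let $K(x,y)$ be a kernel, defined for $x\ne y$ in $\mathbb R^n$, such that for some constant $C>0$ and some nonnegative increasing function $\omega:[0,1)\to[0,\infty)$ satisfying the Dini condition $\int_0^1\frac{\omega(t)}{t}\,dt<\infty$ one has $$|K(x,y)|\le \frac{C}{|x-y|^n}\qquad\text{whenever } x\ne y,$$ $$|K(x,y)-K(\widetilde x,y)|+|K(y,x)-K(y,\widetilde x)|\le\frac{C}{|x-y|^n}\,\omega\!\left(\frac{|x-\widetilde x|}{|x-y|}\right)\qquad\text{whenever } |x-\widetilde x|<\tfrac12|x-y|.$$ Let $T$ be a Calderón–Zygmund operator with kernel $K$, that is, a linear operator that is bounded on $L^s(\mathbb R^n)$ for every $s\in(1,\infty)$ (the operators on different $L^s$ agreeing on common functions) and satisfies, for every $f\in C_{\rm c}^\infty(\mathbb R^n)$, $$T f(x)=\int_{\mathbb R^n}K(x,y)f(y)\,dy\qquad\text{for almost every } x\notin\operatorname{supp} f.$$ Then the commutator $[b,T]f:=b\,T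 f-T(bf)$ is a compact operator from $L^p(\mathbb R^n)$ to $L^q(\mathbb R^n)$. -/

import Mathlib

open MeasureTheory ENNReal

/-- The Dini condition for a modulus of continuity `ω : [0,1) → [0,∞)`: `ω` is nonnegative and
increasing (in the wide sense) on `[0,1)`, and `∫₀¹ ω(t)/t dt < ∞`.
The values of `ω` outside `[0,1)` are irrelevant. -/
structure IsDiniModulus (ω : ℝ → ℝ) : Prop where
  nonneg : ∀ t ∈ Set.Ico (0 : ℝ) 1, 0 ≤ ω t
  monotoneOn : MonotoneOn ω (Set.Ico (0 : ℝ) 1)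
  dini : IntegrableOn (fun t : ℝ => ω t / t) (Set.Ioo (0 : ℝ) 1)

/-- Calderón–Zygmund kernels on `ℝⁿ` with the standard size condition and the smoothness condition
governed by a Dini modulus of continuity. The values of `K` on the diagonal are irrelevant. -/
structure IsCalderonZygmundKernel {n : ℕ}
    (K : EuclideanSpace ℝ (Fin n) → EuclideanSpace ℝ (Fin n) → ℂ) : Prop where
  exists_bounds : ∃ (C : ℝ) (ω : ℝ → ℝ), 0 < C ∧ IsDiniModulus ω ∧
    (∀ x y, x ≠ y → ‖K x y‖ ≤ C / ‖x - y‖ ^ n) ∧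
    (∀ x x' y, ‖x - x'‖ < 1 / 2 * ‖x - y‖ →
      ‖K x y - K x' y‖ + ‖K y x - K y x'‖
        ≤ C / ‖x - y‖ ^ n * ω (‖x - x'‖ / ‖x - y‖))

/-- A Calderón–Zygmund operator on `ℝⁿ` with kernel `K`: a linear operator that is bounded on
`L^s(ℝⁿ)` for every `1 < s < ∞` (given as one bounded linear operator on each of these spaces, any
two of which agree on the functions that belong to both spaces), and that is represented by `K`
off the support of test functions. -/
structure CalderonZygmundOperator {n : ℕ}
    (K : EuclideanSpace ℝ (Fin n) → EuclideanSpace ℝ (Fin n) → ℂ) where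
  /-- The operator on `L^s`, for `1 < s < ∞`. -/
  onLp : ∀ (s : ℝ≥0∞) [Fact (1 ≤ s)], 1 < s → s < ∞ →
    (Lp ℂ s (volume : Measure (EuclideanSpace ℝ (Fin n))) →L[ℂ]
      Lp ℂ s (volume : Measure (EuclideanSpace ℝ (Fin n))))
  consistent : ∀ (s t : ℝ≥0∞) [Fact (1 ≤ s)] [Fact (1 ≤ t)]
    (hs : 1 < s) (hs' : s < ∞) (ht : 1 < t) (ht' : t < ∞)
    (f : Lp ℂ s (volume : Measure (EuclideanSpace ℝ (Fin n))))
    (g : Lp ℂ t (volume : Measure (EuclideanSpace ℝ (Fin n)))),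
    f =ᵐ[volume] g → onLp s hs hs' f =ᵐ[volume] onLp t ht ht' g
  kernel_repr : ∀ (s : ℝ≥0∞) [Fact (1 ≤ s)] (hs : 1 < s) (hs' : s < ∞)
    (f : EuclideanSpace ℝ (Fin n) → ℂ) (hf : ContDiff ℝ ((⊤ : ℕ∞) : WithTop ℕ∞) f) (hc : HasCompactSupport f),
    ∀ᵐ x ∂volume, x ∉ tsupport f →
      onLp s hs hs' ((hf.continuous.memLp_of_hasCompactSupport hc).toLp f) x
        = ∫ y, K x y * f y

/-- The commutator `[b,T] f = b · T f - T (b · f)` as a linear map from `L^p` to `L^q`, where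
`b ∈ L^r` and `1/r + 1/p = 1/q`. By Hölder's inequality, multiplication by `b` maps `L^p` to `L^q`,
so `T` acts on `L^p` in the first term and on `L^q` in the second. -/
noncomputable def CalderonZygmundOperator.commutator {n : ℕ}
    {K : EuclideanSpace ℝ (Fin n) → EuclideanSpace ℝ (Fin n) → ℂ}
    (T : CalderonZygmundOperator K) {p q r : ℝ≥0∞} [Fact (1 ≤ p)] [Fact (1 ≤ q)]
    [ENNReal.HolderTriple r p q] (hq : 1 < q) (hqp : q < p) (hp : p < ∞)
    (b : Lp ℂ r (volume : Measure (EuclideanSpace ℝ (Fin n)))) :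
    Lp ℂ p (volume : Measure (EuclideanSpace ℝ (Fin n))) →ₗ[ℂ]
      Lp ℂ q (volume : Measure (EuclideanSpace ℝ (Fin n))) where
  toFun f := b • T.onLp p (hq.trans hqp) hp f - T.onLp q hq (hqp.trans hp) (b • f)
  map_add' f g := by
    have h : b • (f + g) = (b • f + b • g : Lp ℂ q volume) := Lp.add_smul b f g
    rw [h, map_add, map_add, Lp.add_smul]
    abel
  map_smul' c f := by
    have h (u : Lp ℂ p (volume : Measure (EuclideanSpace ℝ (Fin n)))) :
        b • (c • u) = (c • (b • u : Lp ℂ q volume) : Lp ℂ q volume) := (Lp.smul_comm c b u).symm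
    rw [h, map_smul, map_smul, h, RingHom.id_apply, smul_sub]

/-! By Hölder, `b ↦ [b,T]` is bounded and linear from L^r into the bounded operators L^p → L^q.
Compact operators form a norm-closed subspace, and r < ∞ because q < p, so it suffices to treat the
indicator b of a set of finite measure.

For such b, choose smooth compactly supported cutoffs φ, ψ, both close to b in L^r, with ψ = 1 on a
δ-neighbourhood of a compact set A containing supp φ. Adding and subtracting terms
(`commutator_decomposition`) gives [b,T]f = (b-φ)Tf - T((b-φ)f) + φT((ψ-φ)f) - (ψ-φ)T(φf) +
φT((1-ψ)f) - (1-ψ)T(φf). The first four terms have small norm by Hölder. A second cutoff is needed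
because 1-φ does not vanish near supp φ.

In the last two terms T acts between sets at distance at least δ, so only the kernel matters. The
variable confined to A is discretized: replacing it by a nearby point from a finite subset of A
gives a finite-rank operator. Only smallness of ω near 0 is needed to make the kernel error at most
ε(1+|·|)^{-n} in the other variable. This weight lies in L^{p'} and in L^q, as both exponents exceed
1, so Hölder bounds the error uniformly in f. -/

/-! ### Compactness by finite-dimensional approximation. -/

/-- A bounded operator which, on a dense set, is arbitrarily well approximated (relative to the
norm) by elements of finite-dimensional subspaces is compact. -/
theorem isCompactOperator_of_forall_exists_finiteDimensional {𝕜 X Y : Type*} [RCLike 𝕜]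
    [NormedAddCommGroup X] [NormedSpace 𝕜 X] [NormedAddCommGroup Y] [NormedSpace 𝕜 Y]
    [CompleteSpace Y] (S : X →L[𝕜] Y) {D : Set X} (hD : Dense D)
    (h : ∀ ε : ℝ, 0 < ε → ∃ V : Submodule 𝕜 Y, FiniteDimensional 𝕜 V ∧
      ∀ f ∈ D, ∃ v ∈ V, ‖S f - v‖ ≤ ε * ‖f‖) :
    IsCompactOperator S := by
  suffices TotallyBounded (S '' Metric.closedBall 0 1) by
    change IsCompactOperator (S : X →ₗ[𝕜] Y)
    rw [isCompactOperator_iff_isCompact_closure_image_closedBall (S : X →ₗ[𝕜] Y) zero_lt_one]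
    exact this.closure.isCompact_of_isClosed isClosed_closure
  rw [Metric.totallyBounded_iff]
  intro ε hε
  obtain ⟨V, hV, hVS⟩ := h (ε / 8) (by positivity)
  -- The radius allows for a dense point g near f: ‖g‖ ≤ 2, hence ‖Sg‖ ≤ 2‖S‖, and its approximant v
  -- is within ε/4 of Sg. The final error is at most ε/8 + ε/4 plus something below ε/2.
  have hcpt : IsCompact ((↑) '' Metric.closedBall (0 : V) (2 * ‖S‖ + ε) : Set Y) :=
    (isCompact_closedBall _ _).image continuous_subtype_val
  obtain ⟨t, ht, htV⟩ := Metric.totallyBounded_iff.1 hcpt.totallyBounded (ε / 2) (by positivity)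
  refine ⟨t, ht, ?_⟩
  rintro _ ⟨f, hf, rfl⟩
  rw [mem_closedBall_zero_iff] at hf
  obtain ⟨g, hg, hgD⟩ := Metric.dense_iff.1 hD f (min 1 (ε / (8 * (‖S‖ + 1)))) (by positivity)
  rw [Metric.mem_ball, dist_comm, dist_eq_norm] at hg
  have hS : ‖S f - S g‖ ≤ ε / 8 := by
    rw [← map_sub]
    calc ‖S (f - g)‖ ≤ ‖S‖ * ‖f - g‖ := S.le_opNorm _
      _ ≤ (‖S‖ + 1) * (ε / (8 * (‖S‖ + 1))) := by
        gcongr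
        · linarith
        · exact (hg.trans_le (min_le_right _ _)).le
      _ = ε / 8 := by field_simp
  have hg2 : ‖g‖ ≤ 2 := by
    have h1 := norm_sub_norm_le g f
    rw [norm_sub_rev] at h1
    linarith [hg.trans_le (min_le_left _ _)]
  obtain ⟨v, hvV, hv⟩ := hVS g hgD
  have hv' : ‖S g - v‖ ≤ ε / 4 := by nlinarith
  have hSg : ‖S g‖ ≤ 2 * ‖S‖ := by
    nlinarith [S.le_opNorm g, norm_nonneg S]
  have hvR : ‖v‖ ≤ 2 * ‖S‖ + ε := by
    have h1 := norm_sub_norm_le v (S g)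
    rw [norm_sub_rev] at h1
    linarith
  obtain ⟨y, hyt, hy⟩ := Set.mem_iUnion₂.1
    (htV ⟨⟨v, hvV⟩, by simpa using hvR, rfl⟩)
  refine Set.mem_iUnion₂.2 ⟨y, hyt, ?_⟩
  rw [Metric.mem_ball, dist_eq_norm] at hy ⊢
  calc ‖S f - y‖ = ‖(S f - S g) + (S g - v) + (v - y)‖ := by congr 1; abel
    _ ≤ ‖S f - S g‖ + ‖S g - v‖ + ‖v - y‖ := norm_add₃_le
    _ < ε := by
      have : ‖v - y‖ < ε / 2 := hy
      linarith

/-! ### Regularity of the kernel off the diagonal. -/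

/-- Otherwise ω(t)/t ≥ ε/t on (0,1), and 1/t is not integrable at 0. Monotonicity then turns one
small value into smallness on an interval at 0. -/
theorem IsDiniModulus.exists_lt {ω : ℝ → ℝ} (hω : IsDiniModulus ω) {ε : ℝ} (hε : 0 < ε) :
    ∃ t ∈ Set.Ioo (0 : ℝ) 1, ω t < ε := by
  by_contra! h
  have h1 : IntegrableOn (fun t : ℝ => t ^ (-1 : ℝ)) (Set.Ioo (0 : ℝ) 1) := by
    refine Integrable.mono' (hω.dini.const_mul ε⁻¹)
      (by fun_prop) ?_
    filter_upwards [ae_restrict_mem measurableSet_Ioo] with t ht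
    have h2 := h t ht
    have h0 := ht.1
    rw [Real.rpow_neg_one, Real.norm_of_nonneg (by positivity)]
    rw [inv_mul_eq_div, le_div_iff₀ hε, div_eq_mul_inv, mul_comm]
    gcongr
  rw [intervalIntegral.integrableOn_Ioo_rpow_iff one_pos] at h1
  exact lt_irrefl _ h1

section Kernel

variable {n : ℕ} {K : EuclideanSpace ℝ (Fin n) → EuclideanSpace ℝ (Fin n) → ℂ}

theorem IsCalderonZygmundKernel.swap (hK : IsCalderonZygmundKernel K) :
    IsCalderonZygmundKernel (fun x y => K y x) := by
  obtain ⟨C, ω, hC, hω, hs, hr⟩ := hK.exists_bounds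
  refine ⟨C, ω, hC, hω, fun x y h => ?_, fun x x' y h => ?_⟩
  · rw [norm_sub_rev]; exact hs y x h.symm
  · rw [add_comm]; exact hr x x' y h

/-- Off the diagonal, a Calderón–Zygmund kernel oscillates little on small relative scales. -/
theorem IsCalderonZygmundKernel.exists_oscillation_le (hK : IsCalderonZygmundKernel K) {ε : ℝ}
    (hε : 0 < ε) : ∃ t : ℝ, 0 < t ∧ t ≤ 1 / 2 ∧ ∀ x x' y, ‖x - x'‖ < t * ‖x - y‖ →
      ‖K x y - K x' y‖ ≤ ε / ‖x - y‖ ^ n := by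
  obtain ⟨C, ω, hC, hω, hs, hr⟩ := hK.exists_bounds
  obtain ⟨t, ht, hωt⟩ := hω.exists_lt (div_pos hε hC)
  refine ⟨min t (1 / 2), lt_min ht.1 (by norm_num), min_le_right _ _, fun x x' y h => ?_⟩
  have hxy : 0 < ‖x - y‖ := by
    by_contra! h'
    have h0 : ‖x - y‖ = 0 := le_antisymm h' (norm_nonneg _)
    rw [h0, mul_zero] at h
    exact absurd h (norm_nonneg _).not_gt
  have h1 : ‖x - x'‖ < 1 / 2 * ‖x - y‖ := h.trans_le (by gcongr; exact min_le_right _ _)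
  have h2 : ‖x - x'‖ / ‖x - y‖ ≤ t := by
    rw [div_le_iff₀ hxy]
    exact h.le.trans (by gcongr; exact min_le_left _ _)
  have h3 : ω (‖x - x'‖ / ‖x - y‖) ≤ ω t :=
    hω.monotoneOn ⟨by positivity, h2.trans_lt ht.2⟩ ⟨ht.1.le, ht.2⟩ h2
  calc ‖K x y - K x' y‖ ≤ ‖K x y - K x' y‖ + ‖K y x - K y x'‖ :=
        le_add_of_nonneg_right (norm_nonneg _)
    _ ≤ C / ‖x - y‖ ^ n * ω (‖x - x'‖ / ‖x - y‖) := hr x x' y h1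
    _ ≤ C / ‖x - y‖ ^ n * (ε / C) := by
        gcongr
        exact h3.trans hωt.le
    _ = ε / ‖x - y‖ ^ n := by field_simp

/-- Measurability of K is not assumed; the measurability needed below comes from this continuity. -/
theorem IsCalderonZygmundKernel.continuousAt_left (hK : IsCalderonZygmundKernel K)
    {x y : EuclideanSpace ℝ (Fin n)} (hxy : x ≠ y) : ContinuousAt (fun z => K z y) x := by
  have hxy' : 0 < ‖x - y‖ := norm_pos_iff.2 (sub_ne_zero.2 hxy)
  rw [Metric.continuousAt_iff]
  intro ε hε
  obtain ⟨t, ht, -, h⟩ := hK.exists_oscillation_le (ε := ε / 2 * ‖x - y‖ ^ n) (by positivity)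
  refine ⟨t * ‖x - y‖, by positivity, fun {z} hz => ?_⟩
  rw [dist_comm, dist_eq_norm] at hz ⊢
  have := h x z y hz
  rw [mul_div_cancel_right₀ _ (by positivity)] at this
  linarith

theorem IsCalderonZygmundKernel.continuousAt_right (hK : IsCalderonZygmundKernel K)
    {x y : EuclideanSpace ℝ (Fin n)} (hxy : x ≠ y) : ContinuousAt (K x) y :=
  hK.swap.continuousAt_left hxy.symm

end Kernel

/-! ### The decay weight and its integrability. -/

section Weight

variable {E : Type*} [NormedAddCommGroup E]

/-- The weight `(1 + |x|)^{-n}`. -/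
noncomputable def decayWeight (n : ℕ) (x : E) : ℝ := ((1 + ‖x‖) ^ n)⁻¹

theorem decayWeight_nonneg (n : ℕ) (x : E) : 0 ≤ decayWeight n x := by
  unfold decayWeight; positivity

theorem continuous_decayWeight (n : ℕ) : Continuous (decayWeight n : E → ℝ) := by
  unfold decayWeight
  exact Continuous.inv₀ (by fun_prop) (fun x => by positivity)

/-- If `x` stays in a bounded set and `y` stays away from `x`, then `|x - y|^{-n}` is dominated by
`(1 + |y|)^{-n}`. -/
theorem exists_inv_norm_sub_pow_le (n : ℕ) {A : Set E} (hA : Bornology.IsBounded A) {δ : ℝ}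
    (hδ : 0 < δ) : ∃ M : ℝ, 0 < M ∧ ∀ x ∈ A, ∀ y, δ ≤ ‖x - y‖ →
      (‖x - y‖ ^ n)⁻¹ ≤ M * decayWeight n y := by
  obtain ⟨R, hR, hAR⟩ := hA.exists_pos_norm_le
  -- 1 + |y| ≤ (1 + R) + |x - y|, and 1 + R ≤ ((1 + R)/δ)|x - y| since |x - y| ≥ δ.
  refine ⟨((1 + R) / δ + 1) ^ n, by positivity, fun x hx y hxy => ?_⟩
  have hpos : 0 < ‖x - y‖ := hδ.trans_le hxy
  have h1 : 1 + ‖y‖ ≤ ((1 + R) / δ + 1) * ‖x - y‖ := by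
    have h2 : ‖y‖ ≤ ‖x‖ + ‖x - y‖ := by
      have := norm_sub_le x (x - y)
      rwa [_root_.sub_sub_cancel] at this
    have h3 : (1 + R) ≤ (1 + R) / δ * ‖x - y‖ := by
      rw [div_mul_eq_mul_div, le_div_iff₀ hδ]
      gcongr
    linarith [hAR x hx]
  rw [decayWeight, ← div_eq_mul_inv, inv_eq_one_div, div_le_div_iff₀ (by positivity) (by positivity),
    one_mul, ← mul_pow]
  gcongr

/-- The power (1+|x|)^{-ns} is integrable because ns > n. -/
theorem memLp_decayWeight {n : ℕ} (hn : 1 ≤ n) {s : ℝ≥0∞} (hs : 1 < s) (hs' : s < ∞) :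
    MemLp (decayWeight n) s (volume : Measure (EuclideanSpace ℝ (Fin n))) := by
  have hs0 : s ≠ 0 := (zero_lt_one.trans hs).ne'
  have hs1 : 1 < s.toReal := by
    rw [← ENNReal.toReal_one]
    exact (ENNReal.toReal_lt_toReal (by simp) hs'.ne).2 hs
  have hn' : (1 : ℝ) ≤ n := by exact_mod_cast hn
  rw [← integrable_norm_rpow_iff (continuous_decayWeight n).aestronglyMeasurable hs0 hs'.ne]
  have := integrable_one_add_norm (E := EuclideanSpace ℝ (Fin n)) (μ := volume)
    (r := n * s.toReal) (by rw [finrank_euclideanSpace_fin]; nlinarith)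
  refine this.congr (.of_forall fun x => ?_)
  have h0 : (0 : ℝ) ≤ 1 + ‖x‖ := by positivity
  dsimp only
  rw [Real.norm_of_nonneg (decayWeight_nonneg n x), decayWeight, Real.inv_rpow (by positivity),
    Real.rpow_neg h0, Real.rpow_mul h0, Real.rpow_natCast]

end Weight

/-- A bounded set may be decomposed into finitely many measurable pieces of small diameter. -/
theorem exists_measurable_finite_approx {E : Type*} [MetricSpace E] [MeasurableSpace E]
    [OpensMeasurableSpace E] {A : Set E} (hA : IsCompact A) {η : ℝ} (hη : 0 < η) :
    ∃ (π : E → E) (t : Finset E), (∀ i, MeasurableSet (π ⁻¹' {i})) ∧ ↑t ⊆ A ∧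
      ∀ x ∈ A, π x ∈ t ∧ dist x (π x) < η := by
  classical
  rcases A.eq_empty_or_nonempty with rfl | hne
  · exact ⟨id, ∅, fun i => by simp, by simp, by simp⟩
  have := hne.to_subtype
  have := hA.isSeparable.separableSpace
  -- Taking the points from A itself makes every value of the nearest-point map lie in A.
  let e : ℕ → E := fun k => (TopologicalSpace.denseSeq A k : E)
  have hcov : A ⊆ ⋃ k, Metric.ball (e k) η := by
    intro x hx
    obtain ⟨k, hk⟩ := (TopologicalSpace.denseRange_denseSeq A).exists_dist_lt ⟨x, hx⟩ hη
    exact Set.mem_iUnion.2 ⟨k, hk⟩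
  obtain ⟨s, hs⟩ := hA.elim_finite_subcover _ (fun k => Metric.isOpen_ball) hcov
  obtain ⟨N, hN⟩ := s.exists_le
  let P := SimpleFunc.nearestPt e N
  refine ⟨P, P.range, fun i => P.measurableSet_preimage _, ?_, fun x hx =>
    ⟨P.mem_range_self x, ?_⟩⟩
  · intro i hi
    obtain ⟨x, rfl⟩ := SimpleFunc.mem_range.1 hi
    exact (TopologicalSpace.denseSeq A (SimpleFunc.nearestPtInd e N x)).2
  · obtain ⟨k, hk, hxk⟩ := Set.mem_iUnion₂.1 (hs hx)
    rw [Metric.mem_ball, dist_comm] at hxk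
    have := SimpleFunc.edist_nearestPt_le e x (hN k hk)
    rw [edist_dist, edist_dist, ENNReal.ofReal_le_ofReal_iff dist_nonneg] at this
    rw [dist_comm]
    exact this.trans_lt hxk

/-! ### Finite-rank approximation of off-diagonal kernel operators. -/

section Approximation

variable {n : ℕ} {K : EuclideanSpace ℝ (Fin n) → EuclideanSpace ℝ (Fin n) → ℂ}

/-- The subspace is fixed before the coefficients, which will depend on the function the operator is
applied to. -/
theorem exists_finiteDimensional_ae_eq_sum {α ι : Type*} [MeasurableSpace α] {μ : Measure α}
    {q : ℝ≥0∞} [Fact (1 ≤ q)] (t : Finset ι) (u : ι → α → ℂ) (hu : ∀ i ∈ t, MemLp (u i) q μ) :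
    ∃ V : Submodule ℂ (Lp ℂ q μ), FiniteDimensional ℂ V ∧
      ∀ c : ι → ℂ, ∃ v ∈ V, v =ᵐ[μ] fun x => ∑ i ∈ t, c i * u i x := by
  classical
  let w : t → Lp ℂ q μ := fun i => (hu i i.2).toLp
  refine ⟨Submodule.span ℂ (Set.range w), FiniteDimensional.span_of_finite ℂ (Set.finite_range w),
    fun c => ⟨∑ i : t, c i • w i, Submodule.sum_mem _ fun i _ => Submodule.smul_mem _ _
      (Submodule.subset_span ⟨i, rfl⟩), ?_⟩⟩
  have h1 : ∀ᵐ x ∂μ, ∀ i : t, (c i • w i : Lp ℂ q μ) x = c i * u i x := by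
    rw [ae_all_iff]
    intro i
    filter_upwards [Lp.coeFn_smul (c i) (w i), (hu i i.2).coeFn_toLp] with x h1 h2
    rw [h1, Pi.smul_apply, h2, smul_eq_mul]
  filter_upwards [Lp.coeFn_finsetSum Finset.univ (fun i : t => c i • w i), h1] with x h2 h3
  rw [h2, Finset.sum_apply, ← Finset.sum_coe_sort t]
  exact Finset.sum_congr rfl fun i _ => h3 i

/-- At distance at least δ, an absolute displacement below tδ is a relative one below t. A decaying
bound, rather than a constant, is needed because y ranges over an unbounded set. -/
theorem IsCalderonZygmundKernel.exists_oscillation_le_decayWeight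
    (hK : IsCalderonZygmundKernel K) {A : Set (EuclideanSpace ℝ (Fin n))}
    (hA : Bornology.IsBounded A) {δ ε : ℝ} (hδ : 0 < δ) (hε : 0 < ε) :
    ∃ η : ℝ, 0 < η ∧ ∀ x ∈ A, ∀ x' y, dist x x' < η → δ ≤ dist x y →
      ‖K x y - K x' y‖ ≤ ε * decayWeight n y := by
  obtain ⟨M, hM, hMA⟩ := exists_inv_norm_sub_pow_le n hA hδ
  obtain ⟨t, ht, -, hKt⟩ := hK.exists_oscillation_le (div_pos hε hM)
  refine ⟨t * δ, by positivity, fun x hx x' y hxx' hxy => ?_⟩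
  rw [dist_eq_norm] at hxx' hxy
  calc ‖K x y - K x' y‖ ≤ ε / M / ‖x - y‖ ^ n := hKt x x' y (hxx'.trans_le (by gcongr))
    _ = ε / M * (‖x - y‖ ^ n)⁻¹ := div_eq_mul_inv _ _
    _ ≤ ε / M * (M * decayWeight n y) := by gcongr; exact hMA x hx y hxy
    _ = ε * decayWeight n y := by field_simp

/-- The diagonal point y = x is harmless: g vanishes near it. -/
theorem IsCalderonZygmundKernel.continuous_mul (hK : IsCalderonZygmundKernel K)
    {g : EuclideanSpace ℝ (Fin n) → ℂ} (hg : Continuous g) {x : EuclideanSpace ℝ (Fin n)} {δ : ℝ}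
    (hδ : 0 < δ) (hgx : ∀ y, dist x y < δ → g y = 0) : Continuous fun y => K x y * g y := by
  rw [continuous_iff_continuousAt]
  intro y
  rcases eq_or_ne x y with rfl | hxy
  · refine ContinuousAt.congr (f := fun _ => 0) continuousAt_const ?_
    filter_upwards [Metric.ball_mem_nhds x hδ] with z hz
    rw [hgx z (by rwa [Metric.mem_ball, dist_comm] at hz), mul_zero]
  · exact (hK.continuousAt_right hxy).mul hg.continuousAt

theorem IsCalderonZygmundKernel.integrable_mul (hK : IsCalderonZygmundKernel K)
    {g : EuclideanSpace ℝ (Fin n) → ℂ} (hg : Continuous g) (hgc : HasCompactSupport g)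
    {x : EuclideanSpace ℝ (Fin n)} {δ : ℝ}
    (hδ : 0 < δ) (hgx : ∀ y, dist x y < δ → g y = 0) : Integrable fun y => K x y * g y :=
  (hK.continuous_mul hg hδ hgx).integrable_of_hasCompactSupport hgc.mul_left

/-- Localizing the values of the kernel operator to a compact set gives a nearly
finite-dimensional range, uniformly over functions supported away from that set. -/
theorem IsCalderonZygmundKernel.exists_finiteDimensional_approx_near
    (hK : IsCalderonZygmundKernel K) (q : ℝ≥0∞) [Fact (1 ≤ q)]
    {A : Set (EuclideanSpace ℝ (Fin n))} (hA : IsCompact A) {δ ε : ℝ} (hδ : 0 < δ) (hε : 0 < ε)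
    {φ : EuclideanSpace ℝ (Fin n) → ℂ} (hφ : Continuous φ) (hφ1 : ∀ x, ‖φ x‖ ≤ 1)
    (hφA : ∀ x ∉ A, φ x = 0) :
    ∃ V : Submodule ℂ (Lp ℂ q (volume : Measure (EuclideanSpace ℝ (Fin n)))),
      FiniteDimensional ℂ V ∧ ∀ g : EuclideanSpace ℝ (Fin n) → ℂ, Continuous g →
        HasCompactSupport g → (∀ x ∈ A, ∀ y, dist x y < δ → g y = 0) →
        ∃ v ∈ V, ∀ᵐ x, ‖φ x * (∫ y, K x y * g y) - v x‖ ≤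
          ε * (∫ y, decayWeight n y * ‖g y‖) * A.indicator 1 x := by
  classical
  obtain ⟨η, hη, hKη⟩ := hK.exists_oscillation_le_decayWeight hA.isBounded hδ hε
  obtain ⟨π, t, hπ, htA, hπA⟩ := exists_measurable_finite_approx hA hη
  -- The approximant is φ(x)∫K(πx,y)g(y)dy, a combination of the functions 1_{π=i}φ with
  -- coefficients ∫K(i,y)g(y)dy.
  obtain ⟨V, hV, hVv⟩ := exists_finiteDimensional_ae_eq_sum (q := q) (μ := volume) t
    (fun i => (π ⁻¹' {i}).indicator φ)
    (fun i _ => (hφ.memLp_of_hasCompactSupport (HasCompactSupport.intro hA hφA)).indicator (hπ i))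
  refine ⟨V, hV, fun g hg hgc hgA => ?_⟩
  obtain ⟨v, hv, hvx⟩ := hVv (fun i => ∫ y, K i y * g y)
  refine ⟨v, hv, ?_⟩
  filter_upwards [hvx] with x hx
  rw [hx]
  by_cases hxA : x ∈ A
  · have hπx := hπA x hxA
    rw [Finset.sum_eq_single_of_mem (π x) hπx.1
      (fun i _ hi => by rw [Set.indicator_of_notMem (by simpa using hi.symm), mul_zero]),
      Set.indicator_of_mem (by simp), Set.indicator_of_mem hxA, Pi.one_apply, mul_one, mul_comm,
      ← sub_mul, norm_mul, ← integral_sub (hK.integrable_mul hg hgc hδ (hgA x hxA))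
        (hK.integrable_mul hg hgc hδ (hgA _ (htA hπx.1)))]
    calc ‖∫ y, (K x y * g y - K (π x) y * g y)‖ * ‖φ x‖
        ≤ ‖∫ y, (K x y * g y - K (π x) y * g y)‖ := mul_le_of_le_one_right (norm_nonneg _) (hφ1 x)
      _ ≤ ∫ y, ε * (decayWeight n y * ‖g y‖) := by
          refine norm_integral_le_of_norm_le ?_ (.of_forall fun y => ?_)
          · refine (Continuous.integrable_of_hasCompactSupport ?_ ?_).const_mul ε
            · exact (continuous_decayWeight n).mul hg.norm
            · exact hgc.norm.mul_left
          · by_cases hxy : dist x y < δ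
            · simp [hgA x hxA y hxy]
            · rw [← sub_mul, norm_mul, ← mul_assoc]
              gcongr
              exact hKη x hxA _ y hπx.2 (not_lt.1 hxy)
      _ = ε * ∫ y, decayWeight n y * ‖g y‖ := integral_const_mul _ _
  · have h0 : ∀ i, (π ⁻¹' {i}).indicator φ x = 0 := fun i => by
      simp [Set.indicator_apply, hφA x hxA]
    simp [h0, hφA x hxA, hxA]

/-- Restricting the kernel operator to functions supported in a compact set, and its values to the
complement of a neighbourhood of that set, gives a nearly finite-dimensional range. -/
theorem IsCalderonZygmundKernel.exists_finiteDimensional_approx_far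
    (hK : IsCalderonZygmundKernel K) (hn : 1 ≤ n) {q : ℝ≥0∞} [Fact (1 ≤ q)] (hq : 1 < q)
    (hq' : q < ∞) {A : Set (EuclideanSpace ℝ (Fin n))} (hA : IsCompact A) {δ ε : ℝ} (hδ : 0 < δ)
    (hε : 0 < ε) {χ : EuclideanSpace ℝ (Fin n) → ℂ} (hχ : Continuous χ) (hχ1 : ∀ x, ‖χ x‖ ≤ 1)
    (hχA : ∀ x ∈ A, ∀ y, dist x y < δ → χ y = 0) :
    ∃ V : Submodule ℂ (Lp ℂ q (volume : Measure (EuclideanSpace ℝ (Fin n)))),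
      FiniteDimensional ℂ V ∧ ∀ g : EuclideanSpace ℝ (Fin n) → ℂ, Continuous g →
        (∀ x ∉ A, g x = 0) →
        ∃ v ∈ V, ∀ᵐ x, ‖χ x * (∫ y, K x y * g y) - v x‖ ≤
          ε * (∫ y, A.indicator 1 y * ‖g y‖) * decayWeight n x := by
  classical
  -- Now y is the variable in A, so K(x,y) is replaced by K(x,πy).
  obtain ⟨η, hη, hKη⟩ := hK.swap.exists_oscillation_le_decayWeight hA.isBounded hδ hε
  obtain ⟨π, t, hπ, htA, hπA⟩ := exists_measurable_finite_approx hA hη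
  obtain ⟨M, hM, hMA⟩ := exists_inv_norm_sub_pow_le n hA.isBounded hδ
  obtain ⟨C, ω, hC, hω, hs, -⟩ := hK.exists_bounds
  -- The spanning functions K(·,i)χ are in L^q: i ∈ A and χ vanishes within δ of i, so the size
  -- condition bounds them by a multiple of the weight. The coefficients will be the integrals of g
  -- over {π = i}.
  obtain ⟨V, hV, hVv⟩ := exists_finiteDimensional_ae_eq_sum (q := q) (μ := volume) t
    (fun i x => K x i * χ x) (fun i hi => by
      refine MemLp.mono' ((memLp_decayWeight hn hq hq').const_mul (C * M))
        (hK.swap.continuous_mul hχ hδ (hχA i (htA hi))).aestronglyMeasurable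
        (.of_forall fun x => ?_)
      by_cases hx : dist i x < δ
      · rw [hχA i (htA hi) x hx, mul_zero, norm_zero]
        have := decayWeight_nonneg n x
        positivity
      · have hne : x ≠ i := by
          rintro rfl
          rw [dist_self] at hx
          exact hx hδ
        have h1 := hMA i (htA hi) x (by rwa [not_lt, dist_eq_norm] at hx)
        calc ‖K x i * χ x‖ = ‖K x i‖ * ‖χ x‖ := norm_mul _ _
          _ ≤ ‖K x i‖ := mul_le_of_le_one_right (norm_nonneg _) (hχ1 x)
          _ ≤ C / ‖x - i‖ ^ n := hs x i hne
          _ = C * (‖i - x‖ ^ n)⁻¹ := by rw [div_eq_mul_inv, norm_sub_rev]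
          _ ≤ C * (M * decayWeight n x) := by gcongr
          _ = C * M * decayWeight n x := by ring)
  refine ⟨V, hV, fun g hg hgA => ?_⟩
  have hgc : HasCompactSupport g := HasCompactSupport.intro hA hgA
  have hgi : Integrable g := hg.integrable_of_hasCompactSupport hgc
  obtain ⟨v, hv, hvx⟩ := hVv (fun i => ∫ y, (π ⁻¹' {i}).indicator g y)
  refine ⟨v, hv, ?_⟩
  have hind : ∀ y, A.indicator (1 : EuclideanSpace ℝ (Fin n) → ℝ) y * ‖g y‖ = ‖g y‖ := by
    intro y
    by_cases hy : y ∈ A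
    · simp [hy]
    · simp [hgA y hy]
  simp_rw [hind]
  filter_upwards [hvx] with x hx
  rw [hx]
  by_cases hχx : χ x = 0
  · simp only [hχx, zero_mul, mul_zero, Finset.sum_const_zero, sub_zero, norm_zero]
    have := decayWeight_nonneg n x
    have : 0 ≤ ∫ y, ‖g y‖ := integral_nonneg fun y => norm_nonneg _
    positivity
  have hxA : ∀ y ∈ A, δ ≤ dist y x := fun y hy => by
    by_contra! h
    exact hχx (hχA y hy x h)
  have hgx : ∀ y, dist x y < δ → g y = 0 := fun y hy => by
    by_contra hgy
    have hyA : y ∈ A := by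
      by_contra h
      exact hgy (hgA y h)
    rw [dist_comm] at hy
    exact (hxA y hyA).not_gt hy
  have hsum : (∑ i ∈ t, (∫ y, (π ⁻¹' {i}).indicator g y) * (K x i * χ x)) =
      χ x * ∫ y, ∑ i ∈ t, K x i * (π ⁻¹' {i}).indicator g y := by
    rw [integral_finsetSum _ (fun i _ => (hgi.indicator (hπ i)).const_mul _), Finset.mul_sum]
    refine Finset.sum_congr rfl fun i _ => ?_
    rw [integral_const_mul]
    ring
  rw [hsum, ← mul_sub, norm_mul, ← integral_sub (hK.integrable_mul hg hgc hδ hgx)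
    (integrable_finsetSum _ (fun i _ => (hgi.indicator (hπ i)).const_mul _))]
  refine (mul_le_of_le_one_left (norm_nonneg _) (hχ1 x)).trans ?_
  rw [mul_right_comm, ← integral_const_mul]
  refine norm_integral_le_of_norm_le (hgi.norm.const_mul _) (.of_forall fun y => ?_)
  by_cases hy : y ∈ A
  · have hπy := hπA y hy
    rw [Finset.sum_eq_single_of_mem (π y) hπy.1
      (fun i _ hi => by rw [Set.indicator_of_notMem (by simpa using hi.symm), mul_zero]),
      Set.indicator_of_mem (by simp), ← sub_mul, norm_mul]
    gcongr
    exact hKη y hy _ x hπy.2 (hxA y hy)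
  · have h0 : ∀ i, (π ⁻¹' {i}).indicator g y = 0 := fun i => by
      simp [Set.indicator_apply, hgA y hy]
    simp [h0, hgA y hy]

end Approximation

/-! ### Nested smooth cutoffs. -/

theorem exists_contDiff_cutoff {E : Type*} [NormedAddCommGroup E] [NormedSpace ℝ E]
    [FiniteDimensional ℝ E] {s t : Set E} (hs : IsCompact s) 
    (hst : s ⊆ interior t) :
    ∃ φ : E → ℝ, ContDiff ℝ ((⊤ : ℕ∞) : WithTop ℕ∞) φ ∧ (∀ᶠ x in nhdsSet s, φ x = 1) ∧
      (∀ x ∉ t, φ x = 0) ∧ ∀ x, φ x ∈ Set.Icc (0 : ℝ) 1 := by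
  obtain ⟨f, h1, h2, h3⟩ := exists_contMDiffMap_one_nhds_of_subset_interior (n := ⊤)
    (modelWithCornersSelf ℝ E) hs.isClosed hst
  exact ⟨f, f.contMDiff.contDiff, h1, h2, h3⟩

/-- The indicator function of a set of finite measure is approximated by two smooth functions, the
second of which is `1` near the support of the first. -/
theorem exists_nested_cutoffs {E : Type*} [NormedAddCommGroup E] [NormedSpace ℝ E]
    [FiniteDimensional ℝ E] [MeasurableSpace E] [BorelSpace E] (μ : Measure E) [μ.Regular]
    {s : Set E} (hs : MeasurableSet s) (hμs : μ s ≠ ∞) {ε : ℝ≥0∞} (hε : ε ≠ 0) :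
    ∃ (G A : Set E) (δ : ℝ) (φ ψ : E → ℂ), MeasurableSet G ∧ μ G < ε ∧ IsCompact A ∧ 0 < δ ∧
      ContDiff ℝ ((⊤ : ℕ∞) : WithTop ℕ∞) φ ∧ ContDiff ℝ ((⊤ : ℕ∞) : WithTop ℕ∞) ψ ∧
      HasCompactSupport φ ∧ HasCompactSupport ψ ∧
      (∀ x, ‖φ x‖ ≤ 1) ∧ (∀ x, ‖1 - ψ x‖ ≤ 1) ∧ (∀ x ∉ A, φ x = 0) ∧
      (∀ x ∈ A, ∀ y, dist x y < δ → ψ y = 1) ∧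
      (∀ x, ‖s.indicator 1 x - φ x‖ ≤ ‖G.indicator (fun _ => (1 : ℝ)) x‖) ∧
      (∀ x, ‖ψ x - φ x‖ ≤ ‖G.indicator (fun _ => (1 : ℝ)) x‖) := by
  have hε2 : ε / 2 ≠ 0 := by simp [hε]
  -- The chain is k ⊆ int A, A ⊆ int B, B ⊆ U, with k ⊆ s ⊆ U and U \ k small. The indicator of s, φ
  -- and ψ all equal 1 on k and 0 off U, so they differ only on G = U \ k.
  obtain ⟨U, hsU, hU, -, hUμ⟩ := hs.exists_isOpen_sdiff_lt hμs hε2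
  obtain ⟨k, hks, hk, hkμ⟩ := hs.exists_isCompact_sdiff_lt hμs hε2
  obtain ⟨B, hB, hkB, hBU⟩ := exists_compact_between hk hU (hks.trans hsU)
  obtain ⟨A, hA, hkA, hAB⟩ := exists_compact_between hk isOpen_interior hkB
  obtain ⟨φ, hφ, hφ1, hφ0, hφI⟩ := exists_contDiff_cutoff hk hkA
  obtain ⟨ψ, hψ, hψ1, hψ0, hψI⟩ := exists_contDiff_cutoff hA hAB
  -- Compactness of A turns the neighbourhood where ψ = 1 into a uniform distance δ.
  obtain ⟨W, hWo, hAW, hW⟩ := eventually_nhdsSet_iff_exists.1 hψ1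
  obtain ⟨δ, hδ, hδW⟩ := hA.exists_thickening_subset_open hWo hAW
  have hφk : ∀ x ∈ k, φ x = 1 := fun x hx => hφ1.self_of_nhdsSet x hx
  have hψA : ∀ x ∈ A, ψ x = 1 := fun x hx => hψ1.self_of_nhdsSet x hx
  have hkA' : k ⊆ A := hkA.trans interior_subset
  have hAU : A ⊆ U := (hAB.trans interior_subset).trans hBU
  refine ⟨U \ k, A, δ, fun x => (φ x : ℂ), fun x => (ψ x : ℂ), hU.measurableSet.diff
    hk.measurableSet, ?_, hA, hδ, Complex.ofRealCLM.contDiff.comp hφ,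
    Complex.ofRealCLM.contDiff.comp hψ, HasCompactSupport.intro hA fun x hx => by simp [hφ0 x hx],
    HasCompactSupport.intro hB fun x hx => by simp [hψ0 x hx], fun x => ?_, fun x => ?_,
    fun x hx => by simp [hφ0 x hx], fun x hx y hxy => ?_, fun x => ?_, fun x => ?_⟩
  · calc μ (U \ k) ≤ μ (U \ s ∪ s \ k) := measure_mono (sdiff_triangle U s k)
      _ ≤ μ (U \ s) + μ (s \ k) := measure_union_le _ _
      _ < ε / 2 + ε / 2 := ENNReal.add_lt_add hUμ hkμ
      _ = ε := ENNReal.add_halves ε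
  · rw [Complex.norm_real, Real.norm_of_nonneg (hφI x).1]
    exact (hφI x).2
  · rw [← Complex.ofReal_one, ← Complex.ofReal_sub, Complex.norm_real,
      Real.norm_of_nonneg (by linarith [(hψI x).2])]
    linarith [(hψI x).1]
  · simp only [hW y (hδW (Metric.mem_thickening_iff.2 ⟨x, hx, by rwa [dist_comm]⟩)), Complex.ofReal_one]
  · have key : ∀ a : ℝ, 0 ≤ a → a ≤ 1 → ‖(a - φ x : ℂ)‖ ≤ 1 := fun a h0 h1 => by
      rw [← Complex.ofReal_sub, Complex.norm_real, Real.norm_eq_abs, abs_le]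
      constructor <;> linarith [(hφI x).1, (hφI x).2]
    by_cases hxk : x ∈ k
    · simp [hks hxk, hφk x hxk, hxk]
    by_cases hxU : x ∈ U
    · rw [Set.indicator_of_mem (show x ∈ U \ k from ⟨hxU, hxk⟩), norm_one]
      by_cases hxs : x ∈ s
      · simpa [hxs] using key 1 zero_le_one le_rfl
      · simpa [hxs] using key 0 le_rfl zero_le_one
    · have h1 : x ∉ s := fun h => hxU (hsU h)
      have h2 : x ∉ A := fun h => hxU (hAU h)
      simp [h1, hφ0 x h2]
  · by_cases hxk : x ∈ k
    · simp [hφk x hxk, hxk, hψA x (hkA' hxk)]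
    by_cases hxU : x ∈ U
    · rw [Set.indicator_of_mem (show x ∈ U \ k from ⟨hxU, hxk⟩), norm_one, ← Complex.ofReal_sub,
        Complex.norm_real, Real.norm_eq_abs, abs_le]
      constructor <;> linarith [(hφI x).1, (hφI x).2, (hψI x).1, (hψI x).2]
    · have h1 : x ∉ B := fun h => hxU (hBU h)
      have h2 : x ∉ A := fun h => hxU (hAU h)
      simp [hψ0 x h1, hφ0 x h2]

/-! ### Norm estimates and multiplication in L^p spaces. -/

section Estimates

variable {α : Type*} [MeasurableSpace α] {μ : Measure α}

theorem integral_mul_norm_le_of_holderConjugate {p p' : ℝ≥0∞} [ENNReal.HolderConjugate p' p]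
    {u : α → ℝ} {f g : α → ℂ} (hu0 : ∀ x, 0 ≤ u x) (hu : MemLp u p' μ) (hf : MemLp f p μ)
    (hg : AEStronglyMeasurable g μ) (hgf : ∀ x, ‖g x‖ ≤ ‖f x‖) :
    ∫ x, u x * ‖g x‖ ∂μ ≤ (eLpNorm u p' μ).toReal * (eLpNorm f p μ).toReal := by
  have hgp : MemLp g p μ := hf.mono hg (.of_forall hgf)
  have h1 : ∫ x, u x * ‖g x‖ ∂μ = (eLpNorm (u • g) 1 μ).toReal := by
    rw [eLpNorm_one_eq_lintegral_enorm, ← integral_norm_eq_lintegral_enorm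
      (hu.aestronglyMeasurable.smul hg)]
    refine integral_congr_ae (.of_forall fun x => ?_)
    simp [abs_of_nonneg (hu0 x)]
  rw [h1, ← ENNReal.toReal_mul]
  refine ENNReal.toReal_mono (ENNReal.mul_ne_top hu.eLpNorm_ne_top hf.eLpNorm_ne_top) ?_
  refine (eLpNorm_smul_le_mul_eLpNorm (p := p') (q := p) hg hu.aestronglyMeasurable).trans ?_
  gcongr
  exact eLpNorm_mono hgf

theorem Lp_norm_le_of_ae_norm_le_mul {q : ℝ≥0∞} {F : Lp ℂ q μ} {u : α → ℝ} (hu : MemLp u q μ)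
    {c : ℝ} (hc : 0 ≤ c) (h : ∀ᵐ x ∂μ, ‖F x‖ ≤ c * u x) :
    ‖F‖ ≤ c * (eLpNorm u q μ).toReal := by
  rw [Lp.norm_def]
  refine (ENNReal.toReal_mono (ENNReal.mul_ne_top ENNReal.ofReal_ne_top hu.eLpNorm_ne_top)
    (eLpNorm_le_mul_eLpNorm_of_ae_le_mul (c := c) (g := u) ?_ q)).trans ?_
  · filter_upwards [h] with x hx
    exact hx.trans (by gcongr; exact Real.le_norm_self _)
  · rw [ENNReal.toReal_mul, ENNReal.toReal_ofReal hc]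

end Estimates

section Multiplication

variable {α : Type*} [MeasurableSpace α] {μ : Measure α} {p q r : ℝ≥0∞}
    [ENNReal.HolderTriple r p q]

theorem Lp_sub_smul (b b' : Lp ℂ r μ) (u : Lp ℂ p μ) :
    ((b - b') • u : Lp ℂ q μ) = (b • u : Lp ℂ q μ) - (b' • u : Lp ℂ q μ) := by
  rw [sub_eq_add_neg, Lp.smul_add, Lp.neg_smul, ← sub_eq_add_neg]

theorem Lp_smul_sub (b : Lp ℂ r μ) (u u' : Lp ℂ p μ) :
    (b • (u - u') : Lp ℂ q μ) = (b • u : Lp ℂ q μ) - (b • u' : Lp ℂ q μ) := by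
  rw [sub_eq_add_neg, Lp.add_smul, Lp.smul_neg, ← sub_eq_add_neg]

/-- F and G stand for the images under T in L^p and L^q of the same functions φf and ψf. Both sides
equal φT(ψf) - ψT(φf). The multiplier φ is needed also in L^∞, to act on L^q without changing the
exponent. -/
theorem Lp_smul_cutoff_identity {φ ψ : Lp ℂ r μ} {φ' χ : Lp ℂ ∞ μ} {Fφ Fψ : Lp ℂ p μ}
    {Gφ Gψ : Lp ℂ q μ} (hφ : φ' =ᵐ[μ] φ) (hχ : χ =ᵐ[μ] fun x => 1 - ψ x)
    (hGφ : Fφ =ᵐ[μ] Gφ) (hGψ : Fψ =ᵐ[μ] Gψ) :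
    (φ' • (Gψ - Gφ) : Lp ℂ q μ) - ((ψ - φ) • Fφ : Lp ℂ q μ) =
      (φ • Fψ : Lp ℂ q μ) + (χ • Gφ : Lp ℂ q μ) - Gφ := by
  refine Lp.ext ?_
  refine (Lp.coeFn_sub _ _).trans (Filter.EventuallyEq.trans ?_ (Lp.coeFn_sub _ _).symm)
  filter_upwards [Lp.coeFn_lpSMul (r := q) φ' (Gψ - Gφ), Lp.coeFn_sub Gψ Gφ,
    Lp.coeFn_lpSMul (r := q) (ψ - φ) Fφ, Lp.coeFn_sub ψ φ,
    Lp.coeFn_add (φ • Fψ : Lp ℂ q μ) (χ • Gφ : Lp ℂ q μ),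
    Lp.coeFn_lpSMul (r := q) φ Fψ, Lp.coeFn_lpSMul (r := q) χ Gφ, hφ, hχ, hGφ, hGψ]
    with x h1 h2 h3 h4 h5 h6 h7 h8 h9 h10 h11
  simp only [Pi.sub_apply, h1, h3, h5, Pi.smul_apply', Pi.add_apply, h2, h4, h6, h7, h8, h9, h10,
    h11, smul_eq_mul]
  ring

end Multiplication

/-! ### Dependence on the symbol and splitting of the commutator. -/

section Commutator

variable {n : ℕ} {K : EuclideanSpace ℝ (Fin n) → EuclideanSpace ℝ (Fin n) → ℂ}

namespace CalderonZygmundOperator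

variable (T : CalderonZygmundOperator K) {p q r : ℝ≥0∞} [Fact (1 ≤ p)] [Fact (1 ≤ q)]
    [ENNReal.HolderTriple r p q] (hq : 1 < q) (hqp : q < p) (hp : p < ∞)

/-- The commutator as a bounded operator depending linearly and boundedly on the symbol. -/
noncomputable def commutatorL [Fact (1 ≤ r)] :
    Lp ℂ r (volume : Measure (EuclideanSpace ℝ (Fin n))) →L[ℂ]
      Lp ℂ p (volume : Measure (EuclideanSpace ℝ (Fin n))) →L[ℂ]
        Lp ℂ q (volume : Measure (EuclideanSpace ℝ (Fin n))) :=
  LinearMap.mkContinuous₂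
    (LinearMap.mk₂ ℂ (fun b f => T.commutator hq hqp hp b f)
      (fun b b' f => by
        simp only [commutator, LinearMap.coe_mk, AddHom.coe_mk]
        rw [Lp.smul_add, Lp.smul_add, map_add]
        abel)
      (fun c b f => by
        simp only [commutator, LinearMap.coe_mk, AddHom.coe_mk]
        rw [Lp.smul_assoc, Lp.smul_assoc, map_smul, smul_sub])
      (fun b f g => map_add _ _ _) (fun c b f => map_smul _ _ _))
    (‖T.onLp p (hq.trans hqp) hp‖ + ‖T.onLp q hq (hqp.trans hp)‖)
    (fun b f => by
      simp only [LinearMap.mk₂_apply, commutator, LinearMap.coe_mk, AddHom.coe_mk]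
      refine (norm_sub_le _ _).trans ?_
      have h1 : ‖(b • T.onLp p (hq.trans hqp) hp f : Lp ℂ q volume)‖ ≤
          ‖b‖ * (‖T.onLp p (hq.trans hqp) hp‖ * ‖f‖) :=
        (Lp.norm_smul_le _ _).trans (by gcongr; exact ContinuousLinearMap.le_opNorm _ _)
      have h2 : ‖T.onLp q hq (hqp.trans hp) (b • f)‖ ≤
          ‖T.onLp q hq (hqp.trans hp)‖ * (‖b‖ * ‖f‖) :=
        (ContinuousLinearMap.le_opNorm _ _).trans (by gcongr; exact Lp.norm_smul_le _ _)
      linarith)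

@[simp]
theorem commutatorL_apply [Fact (1 ≤ r)]
    (b : Lp ℂ r (volume : Measure (EuclideanSpace ℝ (Fin n))))
    (f : Lp ℂ p (volume : Measure (EuclideanSpace ℝ (Fin n)))) :
    T.commutatorL hq hqp hp b f = T.commutator hq hqp hp b f := rfl

/-- Splitting of a commutator by two cutoffs `φ`, `ψ` into small and off-diagonal parts. -/
theorem commutator_decomposition
    (b φ ψ : Lp ℂ r (volume : Measure (EuclideanSpace ℝ (Fin n))))
    (φ' χ : Lp ℂ ∞ (volume : Measure (EuclideanSpace ℝ (Fin n))))
    (f fφ fψ : Lp ℂ p (volume : Measure (EuclideanSpace ℝ (Fin n))))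
    (hφ' : φ' =ᵐ[volume] φ) (hχ : χ =ᵐ[volume] fun x => 1 - ψ x)
    (hfφ : fφ =ᵐ[volume] fun x => φ x * f x) (hfψ : fψ =ᵐ[volume] fun x => ψ x * f x) :
    T.commutator hq hqp hp b f =
      (b - φ) • T.onLp p (hq.trans hqp) hp f
        - T.onLp q hq (hqp.trans hp) ((b - φ) • f)
        + (φ' • T.onLp q hq (hqp.trans hp) ((ψ - φ) • f) : Lp ℂ q volume)
        - (ψ - φ) • T.onLp p (hq.trans hqp) hp fφ
        + φ • T.onLp p (hq.trans hqp) hp (f - fψ)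
        - (χ • T.onLp q hq (hqp.trans hp) (φ • f) : Lp ℂ q volume) := by
  -- The cut-off functions lie in both L^p and L^q; consistency identifies the two versions of T on
  -- them.
  have c1 := T.consistent p q (hq.trans hqp) hp hq (hqp.trans hp) fφ (φ • f)
    (hfφ.trans (Lp.coeFn_lpSMul φ f).symm)
  have c2 := T.consistent p q (hq.trans hqp) hp hq (hqp.trans hp) fψ (ψ • f)
    (hfψ.trans (Lp.coeFn_lpSMul ψ f).symm)
  have key := Lp_smul_cutoff_identity (q := q) hφ' hχ c1 c2
  simp only [commutator, LinearMap.coe_mk, AddHom.coe_mk]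
  rw [Lp_sub_smul b φ f, Lp_sub_smul ψ φ f, Lp_sub_smul b φ, map_sub, map_sub, map_sub,
    Lp_smul_sub φ, add_sub_assoc _ _ ((ψ - φ) • _), key]
  abel

end CalderonZygmundOperator

end Commutator

/-! ### Passing from the operator to its kernel. -/

section Localization

variable {n : ℕ} {K : EuclideanSpace ℝ (Fin n) → EuclideanSpace ℝ (Fin n) → ℂ}

/-- Multiplying by `m` the image of a test function `g` under a Calderón–Zygmund operator, one only
sees the kernel, provided that `m` vanishes on the support of `g`. -/
theorem CalderonZygmundOperator.norm_smul_sub_le (T : CalderonZygmundOperator K)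
    {p q r : ℝ≥0∞} [Fact (1 ≤ p)] [Fact (1 ≤ q)] [ENNReal.HolderTriple r p q]
    (hp1 : 1 < p) (hp : p < ∞)
    {m g : EuclideanSpace ℝ (Fin n) → ℂ} (hg : ContDiff ℝ ((⊤ : ℕ∞) : WithTop ℕ∞) g)
    (hgc : HasCompactSupport g) (hmg : ∀ x ∈ tsupport g, m x = 0)
    (M : Lp ℂ r (volume : Measure (EuclideanSpace ℝ (Fin n)))) (hM : M =ᵐ[volume] m)
    (G : Lp ℂ p (volume : Measure (EuclideanSpace ℝ (Fin n)))) (hG : G =ᵐ[volume] g)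
    (v : Lp ℂ q (volume : Measure (EuclideanSpace ℝ (Fin n))))
    {u : EuclideanSpace ℝ (Fin n) → ℝ} (hu : MemLp u q) {c : ℝ} (hc : 0 ≤ c)
    (hv : ∀ᵐ x, ‖m x * (∫ y, K x y * g y) - v x‖ ≤ c * u x) :
    ‖M • T.onLp p hp1 hp G - v‖ ≤ c * (eLpNorm u q volume).toReal := by
  refine Lp_norm_le_of_ae_norm_le_mul hu hc ?_
  have hG' : G = (hg.continuous.memLp_of_hasCompactSupport hgc).toLp :=
    Lp.ext (hG.trans (MemLp.coeFn_toLp _).symm)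
  filter_upwards [T.kernel_repr p hp1 hp g hg hgc, hM, hv,
    Lp.coeFn_sub (M • T.onLp p hp1 hp G : Lp ℂ q volume) v,
    Lp.coeFn_lpSMul (r := q) M (T.onLp p hp1 hp G)] with x h1 h2 h3 h4 h5
  rw [h4, Pi.sub_apply, h5, Pi.smul_apply', h2, smul_eq_mul]
  -- On supp g the kernel formula is unavailable, but m vanishes there.
  by_cases hx : x ∈ tsupport g
  · rw [hmg x hx, zero_mul] at h3 ⊢
    exact h3
  · rw [hG', h1 hx]
    exact h3

end Localization

/-! ### Compactness for indicator symbols, then for general symbols. -/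

section Main

variable {n : ℕ} {K : EuclideanSpace ℝ (Fin n) → EuclideanSpace ℝ (Fin n) → ℂ}
    {p q r : ℝ≥0∞} [Fact (1 ≤ p)] [Fact (1 ≤ q)] [ENNReal.HolderTriple r p q]

/-- The difference is dominated by 1_G, whose L^r norm is at most μ(G)^{1/r}. -/
theorem Lp_norm_toLp_sub_le {α : Type*} [MeasurableSpace α] {μ : Measure α}
    [Fact (1 ≤ r)] (hr : r ≠ ∞) {f g : Lp ℂ r μ} {f' g' : α → ℂ} (hf : f =ᵐ[μ] f')
    (hg : g =ᵐ[μ] g') {G : Set α} {ε : ℝ} (hε : 0 ≤ ε)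
    (hGε : μ G ≤ ENNReal.ofReal ε ^ r.toReal)
    (h : ∀ x, ‖f' x - g' x‖ ≤ ‖G.indicator (fun _ => (1 : ℝ)) x‖) : ‖f - g‖ ≤ ε := by
  have hr0 : 0 < r.toReal :=
    ENNReal.toReal_pos (zero_lt_one.trans_le (Fact.out : 1 ≤ r)).ne' hr
  rw [Lp.norm_def]
  refine ENNReal.toReal_le_of_le_ofReal hε ?_
  calc eLpNorm (f - g : Lp ℂ r μ) r μ ≤ eLpNorm (G.indicator fun _ => (1 : ℝ)) r μ := by
        refine eLpNorm_mono_ae ?_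
        filter_upwards [Lp.coeFn_sub f g, hf, hg] with x h1 h2 h3
        rw [h1, Pi.sub_apply, h2, h3]
        exact h x
    _ ≤ ‖(1 : ℝ)‖ₑ * μ G ^ (1 / r.toReal) := eLpNorm_indicator_const_le _ _
    _ ≤ (ENNReal.ofReal ε ^ r.toReal) ^ (1 / r.toReal) := by
        rw [enorm_one, one_mul]
        gcongr
    _ = ENNReal.ofReal ε := by
        rw [← ENNReal.rpow_mul, mul_one_div_cancel hr0.ne', ENNReal.rpow_one]

set_option maxHeartbeats 2000000 in
theorem CalderonZygmundOperator.isCompactOperator_commutatorL_indicator [Fact (1 ≤ r)]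
    (hn : 1 ≤ n) (hq : 1 < q) (hqp : q < p) (hp : p < ∞) (hr : r ≠ ∞)
    (hK : IsCalderonZygmundKernel K) (T : CalderonZygmundOperator K)
    {s : Set (EuclideanSpace ℝ (Fin n))} (hs : MeasurableSet s) (hμs : volume s ≠ ∞) :
    IsCompactOperator (T.commutatorL (r := r) hq hqp hp (indicatorConstLp r hs hμs (1 : ℂ))) := by
  have hp1 : 1 < p := hq.trans hqp
  have hq' : q < ∞ := hqp.trans hp
  obtain ⟨p', hpp'⟩ : ∃ p', ENNReal.HolderConjugate p' p :=
    ⟨p.conjExponent, (ENNReal.HolderConjugate.conjExponent hp1.le).symm⟩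
  have hp'1 : 1 < p' := lt_of_le_of_ne (ENNReal.HolderConjugate.one_le p' p) fun h =>
    hp.ne ((ENNReal.HolderConjugate.eq_top_iff_eq_one p p').2 h.symm)
  have hp' : p' < ∞ := lt_of_le_of_ne le_top fun h =>
    hp1.ne' ((ENNReal.HolderConjugate.eq_top_iff_eq_one p' p).1 h)
  have hwp' : MemLp (decayWeight n) p' (volume : Measure (EuclideanSpace ℝ (Fin n))) :=
    memLp_decayWeight hn hp'1 hp'
  have hwq : MemLp (decayWeight n) q (volume : Measure (EuclideanSpace ℝ (Fin n))) :=
    memLp_decayWeight hn hq hq'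
  -- Test functions form the dense set because the kernel formula is available only for them.
  refine isCompactOperator_of_forall_exists_finiteDimensional _
    (MeasureTheory.Lp.dense_hasCompactSupport_contDiff hp.ne) fun ε hε => ?_
  set N := ‖T.onLp p hp1 hp‖ + ‖T.onLp q hq hq'‖ with hN
  have hN0 : 0 ≤ N := by positivity
  -- Of the four small terms, two involve T on L^p and two involve T on L^q, for a total of 2ε₁N‖f‖.
  obtain ⟨ε₁, hε₁, hε₁N⟩ : ∃ ε₁ : ℝ, 0 < ε₁ ∧ 2 * (ε₁ * N) ≤ ε / 2 :=
    ⟨ε / (4 * (N + 1)), by positivity, by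
      rw [div_mul_eq_mul_div, ← mul_div_assoc, div_le_div_iff₀ (by positivity) (by positivity)]
      nlinarith⟩
  obtain ⟨G, A, δ, φ, ψ, -, hGμ, hA, hδ, hφ, hψ, hφc, hψc, hφ1, hψ1, hφA, hψA, hsφ, hψφ⟩ :=
    exists_nested_cutoffs volume hs hμs (ε := ENNReal.ofReal ε₁ ^ r.toReal)
      (by simp [hε₁])
  have hχ : Continuous fun x => 1 - ψ x := continuous_const.sub hψ.continuous
  have h1A : ∀ t : ℝ≥0∞, MemLp (A.indicator (1 : EuclideanSpace ℝ (Fin n) → ℝ)) t volume :=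
    fun t => memLp_indicator_const t hA.measurableSet 1 (.inr hA.measure_ne_top)
  set C₁ := (eLpNorm (decayWeight n) p' (volume : Measure (EuclideanSpace ℝ (Fin n)))).toReal *
    (eLpNorm (A.indicator (1 : EuclideanSpace ℝ (Fin n) → ℝ)) q volume).toReal with hC₁
  set C₂ := (eLpNorm (A.indicator (1 : EuclideanSpace ℝ (Fin n) → ℝ)) p' volume).toReal *
    (eLpNorm (decayWeight n) q (volume : Measure (EuclideanSpace ℝ (Fin n)))).toReal with hC₂
  have hC₁0 : 0 ≤ C₁ := by positivity
  have hC₂0 : 0 ≤ C₂ := by positivity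
  -- ε₂ is chosen after the cutoffs, since C₁ and C₂ depend on A.
  obtain ⟨ε₂, hε₂, hε₂C⟩ : ∃ ε₂ : ℝ, 0 < ε₂ ∧ ε₂ * (C₁ + C₂) ≤ ε / 2 :=
    ⟨ε / (2 * (C₁ + C₂ + 1)), by positivity, by
      rw [div_mul_eq_mul_div, div_le_div_iff₀ (by positivity) (by positivity)]
      nlinarith⟩
  obtain ⟨V₁, hV₁, hV₁'⟩ := hK.exists_finiteDimensional_approx_near q hA hδ hε₂ hφ.continuous
    hφ1 hφA
  obtain ⟨V₂, hV₂, hV₂'⟩ := hK.exists_finiteDimensional_approx_far hn hq hq' hA hδ hε₂ hχ hψ1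
    (fun x hx y hxy => by rw [hψA x hx y hxy, sub_self])
  refine ⟨V₁ ⊔ V₂, inferInstance, ?_⟩
  rintro f ⟨g, hfg, hgc, hg⟩
  have hgφ : ContDiff ℝ ((⊤ : ℕ∞) : WithTop ℕ∞) fun x => φ x * g x := hφ.mul hg
  have hgψ : ContDiff ℝ ((⊤ : ℕ∞) : WithTop ℕ∞) fun x => ψ x * g x := hψ.mul hg
  have hgχ : ContDiff ℝ ((⊤ : ℕ∞) : WithTop ℕ∞) fun x => (1 - ψ x) * g x :=
    (contDiff_const.sub hψ).mul hg
  have hgφc : HasCompactSupport fun x => φ x * g x := hgc.mul_left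
  have hgψc : HasCompactSupport fun x => ψ x * g x := hgc.mul_left
  have hgχc : HasCompactSupport fun x => (1 - ψ x) * g x := hgc.mul_left
  obtain ⟨φr, hφr⟩ : ∃ u : Lp ℂ r (volume : Measure (EuclideanSpace ℝ (Fin n))),
      u =ᵐ[volume] φ := ⟨_, (hφ.continuous.memLp_of_hasCompactSupport hφc).coeFn_toLp⟩
  obtain ⟨ψr, hψr⟩ : ∃ u : Lp ℂ r (volume : Measure (EuclideanSpace ℝ (Fin n))),
      u =ᵐ[volume] ψ := ⟨_, (hψ.continuous.memLp_of_hasCompactSupport hψc).coeFn_toLp⟩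
  obtain ⟨φi, hφi⟩ : ∃ u : Lp ℂ ∞ (volume : Measure (EuclideanSpace ℝ (Fin n))),
      u =ᵐ[volume] φ := ⟨_, (hφ.continuous.memLp_of_hasCompactSupport hφc).coeFn_toLp⟩
  obtain ⟨χi, hχi⟩ : ∃ u : Lp ℂ ∞ (volume : Measure (EuclideanSpace ℝ (Fin n))),
      u =ᵐ[volume] fun x => 1 - ψ x :=
    ⟨_, (memLp_top_of_bound hχ.aestronglyMeasurable 1 (.of_forall hψ1)).coeFn_toLp⟩
  obtain ⟨fφ, hfφ⟩ : ∃ u : Lp ℂ p (volume : Measure (EuclideanSpace ℝ (Fin n))),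
      u =ᵐ[volume] fun x => φ x * g x :=
    ⟨_, (hgφ.continuous.memLp_of_hasCompactSupport hgφc).coeFn_toLp⟩
  obtain ⟨fψ, hfψ⟩ : ∃ u : Lp ℂ p (volume : Measure (EuclideanSpace ℝ (Fin n))),
      u =ᵐ[volume] fun x => ψ x * g x :=
    ⟨_, (hgψ.continuous.memLp_of_hasCompactSupport hgψc).coeFn_toLp⟩
  have hφi1 : ‖φi‖ ≤ 1 := by
    rw [Lp.norm_def, eLpNorm_congr_ae hφi]
    refine ENNReal.toReal_le_of_le_ofReal zero_le_one ?_
    rw [eLpNorm_exponent_top]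
    exact eLpNormEssSup_le_of_ae_bound (.of_forall hφ1)
  have hgp : MemLp g p volume := hg.continuous.memLp_of_hasCompactSupport hgc
  have hfnorm : (eLpNorm g p volume).toReal = ‖f‖ := by
    rw [Lp.norm_def, eLpNorm_congr_ae hfg]
  -- the off-diagonal parts
  obtain ⟨v₁, hv₁, hv₁'⟩ := hV₁' (fun x => (1 - ψ x) * g x) hgχ.continuous hgχc
    (fun x hx y hxy => by rw [hψA x hx y hxy, sub_self, zero_mul])
  obtain ⟨v₂, hv₂, hv₂'⟩ := hV₂' (fun x => φ x * g x) hgφ.continuous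
    (fun x hx => by rw [hφA x hx, zero_mul])
  have hJ₁ : ∫ y, decayWeight n y * ‖(1 - ψ y) * g y‖ ≤
      (eLpNorm (decayWeight n) p' (volume : Measure (EuclideanSpace ℝ (Fin n)))).toReal * ‖f‖ := by
    rw [← hfnorm]
    exact integral_mul_norm_le_of_holderConjugate (decayWeight_nonneg n) hwp' hgp
      hgχ.continuous.aestronglyMeasurable
      (fun x => by rw [norm_mul]; exact mul_le_of_le_one_left (norm_nonneg _) (hψ1 x))
  have hJ₂ : ∫ y, A.indicator (1 : EuclideanSpace ℝ (Fin n) → ℝ) y * ‖φ y * g y‖ ≤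
      (eLpNorm (A.indicator (1 : EuclideanSpace ℝ (Fin n) → ℝ)) p' volume).toReal * ‖f‖ := by
    rw [← hfnorm]
    exact integral_mul_norm_le_of_holderConjugate
      (Set.indicator_nonneg fun _ _ => zero_le_one) (h1A p') hgp
      hgφ.continuous.aestronglyMeasurable
      (fun x => by rw [norm_mul]; exact mul_le_of_le_one_left (norm_nonneg _) (hφ1 x))
  have hT₁ : ‖φr • T.onLp p hp1 hp (f - fψ) - v₁‖ ≤ ε₂ * C₁ * ‖f‖ := by
    refine (T.norm_smul_sub_le hp1 hp hgχ hgχc ?_ φr hφr (f - fψ) ?_ v₁ (h1A q) ?_ hv₁').trans ?_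
    · intro x hx
      by_contra hφx
      have hxA : x ∈ A := by
        by_contra h
        exact hφx (hφA x h)
      refine notMem_tsupport_iff_eventuallyEq.2 ?_ hx
      filter_upwards [Metric.ball_mem_nhds x hδ] with y hy
      rw [Metric.mem_ball, dist_comm] at hy
      simp [hψA x hxA y hy]
    · filter_upwards [Lp.coeFn_sub f fψ, hfg, hfψ] with x h1 h2 h3
      rw [h1, Pi.sub_apply, h2, h3]
      ring
    · have : 0 ≤ ∫ y, decayWeight n y * ‖(1 - ψ y) * g y‖ :=
        integral_nonneg fun y => mul_nonneg (decayWeight_nonneg n y) (norm_nonneg _)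
      positivity
    · calc _ ≤ ε₂ * ((eLpNorm (decayWeight n) p'
              (volume : Measure (EuclideanSpace ℝ (Fin n)))).toReal * ‖f‖) *
            (eLpNorm (A.indicator (1 : EuclideanSpace ℝ (Fin n) → ℝ)) q volume).toReal := by
            gcongr
        _ = ε₂ * C₁ * ‖f‖ := by rw [hC₁]; ring
  have hT₂ : ‖χi • T.onLp q hq hq' (φr • f) - v₂‖ ≤ ε₂ * C₂ * ‖f‖ := by
    refine (T.norm_smul_sub_le (r := ∞) hq hq' hgφ hgφc ?_ χi hχi (φr • f) ?_ v₂ hwq ?_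
      hv₂').trans ?_
    · intro x hx
      have hxA : x ∈ A := closure_minimal (fun y hy => by
        by_contra h
        exact hy (by simp [hφA y h])) hA.isClosed hx
      rw [hψA x hxA x (by rwa [dist_self]), sub_self]
    · filter_upwards [Lp.coeFn_lpSMul (r := q) φr f, hfg, hφr] with x h1 h2 h3
      rw [h1, Pi.smul_apply', h2, h3, smul_eq_mul]
    · have : 0 ≤ ∫ y, A.indicator (1 : EuclideanSpace ℝ (Fin n) → ℝ) y * ‖φ y * g y‖ :=
        integral_nonneg fun y => mul_nonneg (Set.indicator_nonneg (fun _ _ => zero_le_one) _)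
          (norm_nonneg _)
      positivity
    · calc _ ≤ ε₂ * ((eLpNorm (A.indicator (1 : EuclideanSpace ℝ (Fin n) → ℝ)) p'
              volume).toReal * ‖f‖) * (eLpNorm (decayWeight n) q
              (volume : Measure (EuclideanSpace ℝ (Fin n)))).toReal := by
            gcongr
        _ = ε₂ * C₂ * ‖f‖ := by rw [hC₂]; ring
  -- the small parts
  have hbφ : ‖indicatorConstLp r hs hμs (1 : ℂ) - φr‖ ≤ ε₁ :=
    Lp_norm_toLp_sub_le hr indicatorConstLp_coeFn hφr hε₁.le hGμ.le hsφ
  have hψφ' : ‖ψr - φr‖ ≤ ε₁ := Lp_norm_toLp_sub_le hr hψr hφr hε₁.le hGμ.le hψφ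
  have hfφn : ‖fφ‖ ≤ ‖f‖ := by
    rw [← hfnorm, Lp.norm_def, eLpNorm_congr_ae hfφ]
    refine ENNReal.toReal_mono hgp.eLpNorm_ne_top (eLpNorm_mono fun x => ?_)
    rw [norm_mul]
    exact mul_le_of_le_one_left (norm_nonneg _) (hφ1 x)
  -- From here on only the closeness of b to φ matters.
  generalize indicatorConstLp r hs hμs (1 : ℂ) = b at hbφ ⊢
  have hdec := T.commutator_decomposition hq hqp hp b φr ψr φi χi f fφ fψ
    (hφi.trans hφr.symm) (by filter_upwards [hχi, hψr] with x h1 h2; rw [h1, h2])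
    (by filter_upwards [hfφ, hfg, hφr] with x h1 h2 h3; rw [h1, h2, h3])
    (by filter_upwards [hfψ, hfg, hψr] with x h1 h2 h3; rw [h1, h2, h3])
  have hP : ∀ u, ‖T.onLp p hp1 hp u‖ ≤ ‖T.onLp p hp1 hp‖ * ‖u‖ :=
    fun u => ContinuousLinearMap.le_opNorm _ _
  have hQ : ∀ u, ‖T.onLp q hq hq' u‖ ≤ ‖T.onLp q hq hq'‖ * ‖u‖ :=
    fun u => ContinuousLinearMap.le_opNorm _ _
  have t₁ : ‖((b - φr) • T.onLp p hp1 hp f : Lp ℂ q volume)‖ ≤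
      ε₁ * (‖T.onLp p hp1 hp‖ * ‖f‖) :=
    (Lp.norm_smul_le _ _).trans (mul_le_mul hbφ (hP f) (norm_nonneg _) hε₁.le)
  have t₂ : ‖T.onLp q hq hq' ((b - φr) • f)‖ ≤ ‖T.onLp q hq hq'‖ * (ε₁ * ‖f‖) :=
    (hQ _).trans (by
      gcongr
      exact (Lp.norm_smul_le _ _).trans (by gcongr))
  have t₃ : ‖(φi • T.onLp q hq hq' ((ψr - φr) • f) : Lp ℂ q volume)‖ ≤
      1 * (‖T.onLp q hq hq'‖ * (ε₁ * ‖f‖)) :=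
    (Lp.norm_smul_le _ _).trans (mul_le_mul hφi1 ((hQ _).trans (by
      gcongr
      exact (Lp.norm_smul_le _ _).trans (by gcongr))) (norm_nonneg _) zero_le_one)
  have t₄ : ‖((ψr - φr) • T.onLp p hp1 hp fφ : Lp ℂ q volume)‖ ≤
      ε₁ * (‖T.onLp p hp1 hp‖ * ‖f‖) :=
    (Lp.norm_smul_le _ _).trans (mul_le_mul hψφ' ((hP fφ).trans (by gcongr))
      (norm_nonneg _) hε₁.le)
  refine ⟨v₁ - v₂, Submodule.sub_mem _ (Submodule.mem_sup_left hv₁) (Submodule.mem_sup_right hv₂),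
    ?_⟩
  rw [commutatorL_apply, hdec]
  generalize ((b - φr) • T.onLp p hp1 hp f : Lp ℂ q volume) = X₁ at t₁ ⊢
  generalize T.onLp q hq hq' ((b - φr) • f) = X₂ at t₂ ⊢
  generalize (φi • T.onLp q hq hq' ((ψr - φr) • f) : Lp ℂ q volume) = X₃ at t₃ ⊢
  generalize ((ψr - φr) • T.onLp p hp1 hp fφ : Lp ℂ q volume) = X₄ at t₄ ⊢
  generalize (φr • T.onLp p hp1 hp (f - fψ) : Lp ℂ q volume) = X₅ at hT₁ ⊢
  generalize (χi • T.onLp q hq hq' (φr • f) : Lp ℂ q volume) = X₆ at hT₂ ⊢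
  calc ‖X₁ - X₂ + X₃ - X₄ + X₅ - X₆ - (v₁ - v₂)‖
      = ‖X₁ - X₂ + X₃ - X₄ + (X₅ - v₁) - (X₆ - v₂)‖ := by congr 1; abel
    _ ≤ ‖X₁‖ + ‖X₂‖ + ‖X₃‖ + ‖X₄‖ + ‖X₅ - v₁‖ + ‖X₆ - v₂‖ :=
        (norm_sub_le _ _).trans (by
          gcongr
          refine (norm_add_le _ _).trans ?_
          gcongr
          refine (norm_sub_le _ _).trans ?_
          gcongr
          refine (norm_add_le _ _).trans ?_
          gcongr
          exact norm_sub_le _ _)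
    _ ≤ (2 * (ε₁ * N) + ε₂ * (C₁ + C₂)) * ‖f‖ := by rw [hN]; linarith
    _ ≤ ε * ‖f‖ := by
        gcongr
        linarith

end Main

theorem theorem2p5 (n : ℕ) (hn : 1 ≤ n) (p q r : ℝ≥0∞)
    [Fact (1 ≤ p)] [Fact (1 ≤ q)] [ENNReal.HolderTriple r p q]
    (hq : 1 < q) (hqp : q < p) (hp : p < ∞)
    (b : Lp ℂ r (volume : Measure (EuclideanSpace ℝ (Fin n))))
    (K : EuclideanSpace ℝ (Fin n) → EuclideanSpace ℝ (Fin n) → ℂ)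
    (hK : IsCalderonZygmundKernel K) (T : CalderonZygmundOperator K) :
    IsCompactOperator (T.commutator hq hqp hp b) := by
  have hr1 : Fact (1 ≤ r) := ⟨hq.le.trans (ENNReal.HolderTriple.le r p q)⟩
  -- r = ∞ would force p = q. Finiteness of r gives density of simple functions in L^r.
  have hr : r ≠ ∞ := by
    rintro rfl
    have := ENNReal.HolderTriple.inv_add_inv_eq_inv ∞ p q
    rw [ENNReal.inv_top, zero_add, inv_inj] at this
    exact hqp.ne' this
  change IsCompactOperator (T.commutatorL hq hqp hp b)
  induction b using Lp.induction hr with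
  | @indicatorConst c s hs hμs =>
    rw [Lp.simpleFunc.coe_indicatorConst]
    have : indicatorConstLp r hs hμs.ne c =
        c • indicatorConstLp r hs hμs.ne (1 : ℂ) := by
      ext1
      filter_upwards [indicatorConstLp_coeFn (p := r) (hs := hs) (hμs := hμs.ne) (c := c),
        indicatorConstLp_coeFn (p := r) (hs := hs) (hμs := hμs.ne) (c := (1 : ℂ)),
        Lp.coeFn_smul c (indicatorConstLp r hs hμs.ne (1 : ℂ))] with x h1 h2 h3
      rw [h1, h3, Pi.smul_apply, h2]
      by_cases hx : x ∈ s <;> simp [hx]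
    rw [this, map_smul]
    exact (T.isCompactOperator_commutatorL_indicator hn hq hqp hp hr hK hs hμs.ne).smul c
  | add hf hg _ h₁ h₂ =>
    rw [map_add]
    exact h₁.add h₂
  | isClosed =>
    exact isClosed_setOfPred_isCompactOperator.preimage (T.commutatorL hq hqp hp).continuous
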